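/- Let $d,m\in\mathbb{N}$, let $p:\mathbb{R}^d\to[0,\infty)$ be a continuously differentiable probability density, and let $\Phi=[\phi_1,\dots,\phi_m]:\mathbb{R}^d\to\mathbb{R}^{d\times m}$ be continuously differentiable, with columns $\phi_j:\mathbb{R}^d\to\mathbb{R}^d$. For a $C^1$ vector field $\phi:\mathbb{R}^d\to\mathbb{R}^d$ put $\mathcal{T}_p\phi=\nabla\cdot\phi+\phi\cdot\nabla\log p$, and define the generalized Langevin Stein operator by $$(\mathcal{T}_{p,m}\Phi)(x)=\nabla\cdot\Phi(x)+\Phi(x)^\top\nabla\log p(x)\in\mathbb{R}^m,\qquad (\nabla\cdot\Phi(x))_j=\sum_{i=1}^d\frac{\partial\Phi_{ij}}{\partial x_i}(x),$$ so that its $j$-th component is $\mathcal{T}_p\phi_j$. (If $p$ vanishes at some points, $\nabla\log p$ is given an arbitrary value there; this set has probability zero under $p$.) Assume that for every $j=1,\dots,m$ $$\mathbb{E}_{X\sim p}\big[|(\mathcal{T}_p\phi_j)(X)|\big]<\infty\qquad\text{and}\qquad \lim_{R\to\infty}\int_{\partial B_R}p(x)\,\phi_j(x)\cdot n(x)\,dS(x)=0,$$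 where $B_R=\{x:\|x\|_2\le R\}$, $n(x)$ is the outward unit normal and $dS$ is the surface measure on $\partial B_R$. Then $(\mathcal{T}_{p,m}\Phi)(X)$ is integrable for $X\sim p$, and $$\mathbb{E}_{X\sim p}\big[(\mathcal{T}_{p,m}\Phi)(X)\big]=0\in\mathbb{R}^m.$$ -/

import Mathlib

open Filter MeasureTheory Topology
open scoped Matrix

noncomputable section

namespace LangevinStein

/-- `ℝᵈ` with its Euclidean norm. -/
abbrev Euc (d : ℕ) : Type := EuclideanSpace ℝ (Fin d)

/-- `p` is a continuously differentiable probability density on `ℝᵈ` (with respect to Lebesgue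
measure). It may vanish at some points. -/
structure IsC1Density {d : ℕ} (p : Euc d → ℝ) : Prop where
  contDiff : ContDiff ℝ 1 p
  nonneg : ∀ x, 0 ≤ p x
  lintegral_eq_one : ∫⁻ x, ENNReal.ofReal (p x) = 1

/-- The probability law with Lebesgue density `p`. -/
def law {d : ℕ} (p : Euc d → ℝ) : Measure (Euc d) :=
  volume.withDensity (fun x => ENNReal.ofReal (p x))

/-- The score `∇ log p`. Where `p` vanishes its value is a convention; such points form a null set
for `law p`. -/
def score {d : ℕ} (p : Euc d → ℝ) (x : Euc d) : Euc d :=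
  gradient (fun y => Real.log (p y)) x

/-- The partial derivative `∂f/∂xᵢ`. -/
def partialDeriv {d : ℕ} (i : Fin d) (f : Euc d → ℝ) (x : Euc d) : ℝ :=
  fderiv ℝ f x (EuclideanSpace.single i 1)

/-- The divergence `∇ · φ` of a vector field. -/
def divergence {d : ℕ} (φ : Euc d → Euc d) (x : Euc d) : ℝ :=
  ∑ i : Fin d, partialDeriv i (fun y => φ y i) x

/-- The Langevin Stein operator `T_p φ = ∇ · φ + φ · ∇ log p` on vector fields. -/
def steinOp {d : ℕ} (p : Euc d → ℝ) (φ : Euc d → Euc d) (x : Euc d) : ℝ :=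
  divergence φ x + inner ℝ (φ x) (score p x)

/-- The `j`-th column of a matrix-valued function, as a vector field. -/
def column {d m : ℕ} (Φ : Euc d → Matrix (Fin d) (Fin m) ℝ) (j : Fin m) (x : Euc d) : Euc d :=
  WithLp.toLp 2 (fun i => Φ x i j)

/-- The column-wise divergence `(∇ · Φ)ⱼ = ∑ᵢ ∂Φᵢⱼ/∂xᵢ` of a matrix-valued function. -/
def matDivergence {d m : ℕ} (Φ : Euc d → Matrix (Fin d) (Fin m) ℝ) (x : Euc d) : Euc m :=
  WithLp.toLp 2 (fun j => ∑ i : Fin d, partialDeriv i (fun y => Φ y i j) x)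

/-- The generalized Langevin Stein operator `T_{p,m} Φ = ∇ · Φ + Φᵀ ∇ log p`. -/
def genSteinOp {d m : ℕ} (p : Euc d → ℝ) (Φ : Euc d → Matrix (Fin d) (Fin m) ℝ)
    (x : Euc d) : Euc m :=
  matDivergence Φ x + WithLp.toLp 2 ((Φ x)ᵀ *ᵥ (score p x).ofLp)

/-- The generalized operator stacks the scalar operator applied to the columns. -/
theorem genSteinOp_apply {d m : ℕ} (p : Euc d → ℝ) (Φ : Euc d → Matrix (Fin d) (Fin m) ℝ)
    (x : Euc d) (j : Fin m) : genSteinOp p Φ x j = steinOp p (column Φ j) x := by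
  simp [genSteinOp, steinOp, matDivergence, divergence, column, Matrix.mulVec, dotProduct,
    PiLp.inner_apply, mul_comm]

/-- Surface measure on the sphere `∂B_R = {x : ‖x‖ = R}` (for `R > 0`), as a measure on `ℝᵈ`: the
surface measure of the unit sphere, transported by `ω ↦ R ω` and scaled by `R ^ (d - 1)`. For
`d = 1` it is the counting measure on `{-R, R}`. -/
def sphereMeasure (d : ℕ) (R : ℝ) : Measure (Euc d) :=
  ENNReal.ofReal (R ^ (d - 1)) •
    ((volume : Measure (Euc d)).toSphere.map
      (fun ω : Metric.sphere (0 : Euc d) 1 => R • (ω : Euc d)))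

/-- The outward unit normal at a point `x ≠ 0` of the centred sphere through `x`. -/
def outwardNormal {d : ℕ} (x : Euc d) : Euc d := ‖x‖⁻¹ • x

/-- The boundary flux `∫_{∂B_R} p(x) φ(x) · n(x) dS(x)`. -/
def boundaryFlux {d : ℕ} (p : Euc d → ℝ) (φ : Euc d → Euc d) (R : ℝ) : ℝ :=
  ∫ x, p x * inner ℝ (φ x) (outwardNormal x) ∂(sphereMeasure d R)

end LangevinStein

end

/-!
The theorem is the divergence theorem on all of `ℝᵈ`. Write `F = p φ` for a column `φ` of `Φ`.
Then `p · T_p φ = ∇ · F` at every point: where `p > 0` this is the product rule together with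
`p ∇ log p = ∇ p`, and a zero of `p` is a minimum of `p`, so that `∇ p` vanishes there and both
sides are zero (`density_mul_steinOp`). It remains to show that the integral of an integrable
divergence `∇ · F` is zero as soon as the flux of `F` through `∂B_R` tends to zero
(`integral_divergence_eq_zero`).

The divergence theorem on balls is avoided by smearing the sphere. Let `χ_R` be a smooth radial
cutoff, equal to `1` on `B_R` and to `0` outside `B_{2R}`. Integration by parts against the
compactly supported `χ_R` and polar coordinates give
`∫ χ_R ∇ · F = -∫ ⟨∇ χ_R, F⟩ = -∫₀^∞ χ_R'(r) flux(r) dr`.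
The weight `χ_R'` lives on `[R, 2R]` and is bounded there by `C / R`, so the right-hand side is at
most `C · sup_{r ≥ R} |flux r|`, which tends to zero; the left-hand side tends to `∫ ∇ · F` by
dominated convergence.
-/

noncomputable section

namespace LangevinStein

/-! ### Integration over spheres and polar coordinates -/

theorem integral_sphereMeasure {d : ℕ} {r : ℝ} (hr : 0 < r) (g : Euc d → ℝ) :
    ∫ x, g x ∂(sphereMeasure d r) =
      r ^ (d - 1) * ∫ ω : Metric.sphere (0 : Euc d) 1,
        g (r • (ω : Euc d)) ∂(volume : Measure (Euc d)).toSphere := by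
  have hemb : MeasurableEmbedding
      (fun ω : Metric.sphere (0 : Euc d) 1 => r • (ω : Euc d)) :=
    (Homeomorph.smulOfNeZero r hr.ne').measurableEmbedding.comp
      (MeasurableEmbedding.subtype_coe Metric.isClosed_sphere.measurableSet)
  rw [sphereMeasure, integral_smul_measure, hemb.integral_map,
    ENNReal.toReal_ofReal (by positivity), smul_eq_mul]

/-- A radial factor is constant on a sphere and can be pulled out of the integral. -/
theorem integral_sphereMeasure_radial_mul {d : ℕ} {r : ℝ} (hr : 0 < r) (w : ℝ → ℝ)
    (g : Euc d → ℝ) :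
    ∫ x, w ‖x‖ * g x ∂(sphereMeasure d r) = w r * ∫ x, g x ∂(sphereMeasure d r) := by
  rw [integral_sphereMeasure hr, integral_sphereMeasure hr]
  have h (ω : Metric.sphere (0 : Euc d) 1) : ‖r • (ω : Euc d)‖ = r := by
    rw [norm_smul, Real.norm_of_nonneg hr.le, mem_sphere_zero_iff_norm.1 ω.2, mul_one]
  simp only [h, integral_const_mul]
  ring

theorem integral_eq_integral_sphereMeasure {d : ℕ} (hd : d ≠ 0) {g : Euc d → ℝ}
    (hg : Integrable g) :
    ∫ x, g x = ∫ r in Set.Ioi (0 : ℝ), ∫ x, g x ∂(sphereMeasure d r) := by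
  have : Nonempty (Fin d) := ⟨⟨0, Nat.pos_of_ne_zero hd⟩⟩
  have hmp := (volume : Measure (Euc d)).measurePreserving_homeomorphUnitSphereProd
  have hemb := (homeomorphUnitSphereProd (Euc d)).measurableEmbedding
  let G : Metric.sphere (0 : Euc d) 1 × Set.Ioi (0 : ℝ) → ℝ :=
    fun q => g ((q.2 : ℝ) • (q.1 : Euc d))
  have hG (x : ({0}ᶜ : Set (Euc d))) : G (homeomorphUnitSphereProd (Euc d) x) = g x := by
    have : ‖(x : Euc d)‖ ≠ 0 := norm_ne_zero_iff.2 x.2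
    simp [G, smul_smul, this]
  have hGint : Integrable G ((volume : Measure (Euc d)).toSphere.prod
      (Measure.volumeIoiPow (Module.finrank ℝ (Euc d) - 1))) := by
    rw [← hmp.integrable_comp_emb hemb]
    have h : Integrable (g ∘ ((↑) : ({0}ᶜ : Set (Euc d)) → Euc d))
        ((volume : Measure (Euc d)).comap (↑)) :=
      (integrableOn_iff_comap_subtypeVal (measurableSet_singleton _).compl).1 hg.integrableOn
    exact h.congr (.of_forall fun x => (hG x).symm)
  calc ∫ x, g x
      = ∫ x : ({0}ᶜ : Set (Euc d)), g x ∂((volume : Measure (Euc d)).comap (↑)) := by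
        rw [integral_subtype_comap (measurableSet_singleton _).compl, restrict_compl_singleton]
    _ = ∫ q, G q ∂((volume : Measure (Euc d)).toSphere.prod
          (Measure.volumeIoiPow (Module.finrank ℝ (Euc d) - 1))) := by
        rw [← hmp.integral_comp hemb]
        exact integral_congr_ae (.of_forall fun x => (hG x).symm)
    _ = ∫ r : Set.Ioi (0 : ℝ), (∫ ω, G (ω, r) ∂(volume : Measure (Euc d)).toSphere)
          ∂(Measure.volumeIoiPow (d - 1)) := by
        rw [integral_prod_symm _ hGint, finrank_euclideanSpace_fin]
    _ = ∫ r in Set.Ioi (0 : ℝ), ∫ x, g x ∂(sphereMeasure d r) := by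
        simp only [Measure.volumeIoiPow, ENNReal.ofReal]
        rw [integral_withDensity_eq_integral_smul
            (measurable_subtype_coe.pow_const _).real_toNNReal,
          integral_subtype_comap measurableSet_Ioi fun r : ℝ => Real.toNNReal (r ^ (d - 1)) •
            ∫ ω : Metric.sphere (0 : Euc d) 1, g (r • (ω : Euc d))
              ∂(volume : Measure (Euc d)).toSphere]
        refine setIntegral_congr_fun measurableSet_Ioi fun r hr => ?_
        rw [integral_sphereMeasure hr, NNReal.smul_def,
          Real.coe_toNNReal _ (pow_nonneg (le_of_lt hr) _), smul_eq_mul]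

/-! ### Radial cutoffs -/

/-- A smooth radial cutoff: it is `1` on the ball of radius `R` and `0` outside the ball of radius
`√2 R`. Composing with `‖x‖²` instead of `‖x‖` keeps it smooth at the origin. -/
def cutoff {d : ℕ} (R : ℝ) (x : Euc d) : ℝ := Real.smoothTransition (2 - ‖x‖ ^ 2 / R ^ 2)

/-- The derivative of the profile of `cutoff R` with respect to the radius. -/
def cutoffSlope (R r : ℝ) : ℝ :=
  deriv Real.smoothTransition (2 - r ^ 2 / R ^ 2) * -(2 * r / R ^ 2)

theorem contDiff_cutoff {d : ℕ} (R : ℝ) : ContDiff ℝ 1 (cutoff (d := d) R) :=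
  (Real.smoothTransition.contDiff (n := 1)).comp
    (contDiff_const.sub ((contDiff_norm_sq ℝ).div_const _))

theorem norm_cutoff_le_one {d : ℕ} (R : ℝ) (x : Euc d) : ‖cutoff R x‖ ≤ 1 := by
  rw [cutoff, Real.norm_of_nonneg (Real.smoothTransition.nonneg _)]
  exact Real.smoothTransition.le_one _

theorem cutoff_eq_one {d : ℕ} {R : ℝ} (hR : 0 < R) {x : Euc d} (hx : ‖x‖ ≤ R) :
    cutoff R x = 1 := by
  apply Real.smoothTransition.one_of_one_le
  have : ‖x‖ ^ 2 / R ^ 2 ≤ 1 := (div_le_one (by positivity)).2 (by gcongr)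
  linarith

theorem hasCompactSupport_cutoff {d : ℕ} {R : ℝ} (hR : 0 < R) :
    HasCompactSupport (cutoff (d := d) R) := by
  refine HasCompactSupport.of_support_subset_isCompact
    (isCompact_closedBall (0 : Euc d) (2 * R)) fun x hx => ?_
  rw [mem_closedBall_zero_iff]
  by_contra! h
  refine hx (Real.smoothTransition.zero_of_nonpos ?_)
  have : 2 ≤ ‖x‖ ^ 2 / R ^ 2 := (le_div_iff₀ (by positivity)).2 (by nlinarith)
  linarith

theorem fderiv_cutoff_apply {d : ℕ} (R : ℝ) (x v : Euc d) :
    fderiv ℝ (cutoff R) x v = cutoffSlope R ‖x‖ * inner ℝ v (outwardNormal x) := by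
  have hη : HasDerivAt Real.smoothTransition
      (deriv Real.smoothTransition (2 - ‖x‖ ^ 2 / R ^ 2)) (2 - ‖x‖ ^ 2 / R ^ 2) :=
    ((Real.smoothTransition.contDiff (n := 1)).differentiable one_ne_zero _).hasDerivAt
  have hs : HasFDerivAt (fun y : Euc d => 2 - ‖y‖ ^ 2 / R ^ 2)
      (-((R ^ 2)⁻¹ • (2 • innerSL ℝ x))) x := by
    simpa only [div_eq_inv_mul] using
      (((hasStrictFDerivAt_norm_sq x).hasFDerivAt).const_mul ((R ^ 2)⁻¹)).const_sub 2
  have h : HasFDerivAt (cutoff R) _ x := hη.comp_hasFDerivAt x hs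
  rw [h.fderiv, cutoffSlope, outwardNormal]
  rcases eq_or_ne x 0 with rfl | hx
  · simp
  · have : ‖x‖ ≠ 0 := norm_ne_zero_iff.2 hx
    simp only [smul_apply, neg_apply, innerSL_apply_apply,
      real_inner_smul_right, real_inner_comm, smul_eq_mul, nsmul_eq_mul]
    push_cast
    field_simp

theorem deriv_smoothTransition_of_one_lt {t : ℝ} (ht : 1 < t) :
    deriv Real.smoothTransition t = 0 := by
  have : Real.smoothTransition =ᶠ[𝓝 t] fun _ => (1 : ℝ) := by
    filter_upwards [lt_mem_nhds ht] with s hs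
    exact Real.smoothTransition.one_of_one_le hs.le
  rw [this.deriv_eq, deriv_const]

theorem deriv_smoothTransition_of_neg {t : ℝ} (ht : t < 0) :
    deriv Real.smoothTransition t = 0 := by
  have : Real.smoothTransition =ᶠ[𝓝 t] fun _ => (0 : ℝ) := by
    filter_upwards [gt_mem_nhds ht] with s hs
    exact Real.smoothTransition.zero_of_nonpos hs.le
  rw [this.deriv_eq, deriv_const]

/-- The slope of the cutoff is concentrated on `[R, 2R]` and of size `O(1 / R)`, so that its
integral over the radius is bounded uniformly in `R`. -/
theorem exists_abs_cutoffSlope_le :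
    ∃ C : ℝ, 0 ≤ C ∧ ∀ R r : ℝ, 0 < R → 0 < r →
      |cutoffSlope R r| ≤ (Set.Icc R (2 * R)).indicator (fun _ => C / R) r := by
  have hcont : Continuous (deriv Real.smoothTransition) :=
    (Real.smoothTransition.contDiff (n := 1)).continuous_deriv le_rfl
  obtain ⟨K, hK⟩ := (isCompact_Icc (a := (-2 : ℝ)) (b := 1)).exists_bound_of_continuousOn
    hcont.continuousOn
  have hK0 : 0 ≤ K := (norm_nonneg _).trans (hK 0 (by norm_num))
  refine ⟨K * 4, by positivity, fun R r hR hr => ?_⟩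
  by_cases h : r ∈ Set.Icc R (2 * R)
  · have h1 : 1 ≤ r ^ 2 / R ^ 2 := (one_le_div (by positivity)).2 (by gcongr; exact h.1)
    have h2 : r ^ 2 / R ^ 2 ≤ 4 := (div_le_iff₀ (by positivity)).2 (by nlinarith [h.2])
    rw [Set.indicator_of_mem h, cutoffSlope, abs_mul, abs_neg, mul_div_assoc K 4 R]
    refine mul_le_mul (hK _ ⟨by linarith, by linarith⟩) ?_ (abs_nonneg _) hK0
    · rw [abs_of_pos (by positivity), div_le_div_iff₀ (by positivity) hR]
      nlinarith [mul_le_mul_of_nonneg_right h.2 hR.le]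
  · rw [Set.indicator_of_notMem h, abs_nonpos_iff, cutoffSlope]
    rcases lt_or_ge r R with h' | h'
    · have : r ^ 2 / R ^ 2 < 1 := (div_lt_one (by positivity)).2 (by gcongr)
      rw [deriv_smoothTransition_of_one_lt (by linarith), zero_mul]
    · have h'' : 2 * R < r := by
        by_contra! h3
        exact h ⟨h', h3⟩
      have : 2 < r ^ 2 / R ^ 2 := (lt_div_iff₀ (by positivity)).2 (by nlinarith)
      rw [deriv_smoothTransition_of_neg (by linarith), zero_mul]

/-! ### Divergences with vanishing flux at infinity -/

theorem continuous_divergence {d : ℕ} {F : Euc d → Euc d} (hF : ContDiff ℝ 1 F) :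
    Continuous (divergence F) :=
  continuous_finsetSum _ fun i _ =>
    (((contDiff_piLp 2).1 hF i).continuous_fderiv one_ne_zero).clm_apply continuous_const

theorem integral_mul_divergence {d : ℕ} {χ : Euc d → ℝ} {F : Euc d → Euc d}
    (hχ : ContDiff ℝ 1 χ) (hχc : HasCompactSupport χ) (hF : ContDiff ℝ 1 F) :
    ∫ x, χ x * divergence F x = -∫ x, fderiv ℝ χ x (F x) := by
  have hFi (i : Fin d) : ContDiff ℝ 1 (fun x => F x i) := (contDiff_piLp 2).1 hF i
  have hDF (i : Fin d) : Continuous (partialDeriv i fun y => F y i) :=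
    ((hFi i).continuous_fderiv one_ne_zero).clm_apply continuous_const
  have hDχ (i : Fin d) : Continuous (partialDeriv i χ) :=
    (hχ.continuous_fderiv one_ne_zero).clm_apply continuous_const
  have hDχc (i : Fin d) : HasCompactSupport (partialDeriv i χ) :=
    hχc.fderiv_apply (𝕜 := ℝ) _
  have h1 (i : Fin d) : Integrable fun x => χ x * partialDeriv i (fun y => F y i) x :=
    (hχ.continuous.mul (hDF i)).integrable_of_hasCompactSupport hχc.mul_right
  have h2 (i : Fin d) : Integrable fun x => partialDeriv i χ x * F x i :=
    ((hDχ i).mul (hFi i).continuous).integrable_of_hasCompactSupport (hDχc i).mul_right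
  have h3 (i : Fin d) : Integrable fun x => χ x * F x i :=
    (hχ.continuous.mul (hFi i).continuous).integrable_of_hasCompactSupport hχc.mul_right
  have hsum (x : Euc d) : fderiv ℝ χ x (F x) = ∑ i, partialDeriv i χ x * F x i := by
    conv_lhs => rw [← (EuclideanSpace.basisFun (Fin d) ℝ).sum_repr (F x)]
    simp [partialDeriv, mul_comm]
  simp only [hsum, divergence, Finset.mul_sum]
  rw [integral_finsetSum _ fun i _ => h1 i, integral_finsetSum _ fun i _ => h2 i,
    ← Finset.sum_neg_distrib]
  exact Finset.sum_congr rfl fun i _ => integral_mul_fderiv_eq_neg_fderiv_mul_of_integrable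
    (h2 i) (h1 i) (h3 i) (fun x _ => hχ.differentiable one_ne_zero x)
    (fun x _ => (hFi i).differentiable one_ne_zero x)

/-- The smeared divergence theorem: testing a divergence against a radial cutoff averages the flux
over the radii. -/
theorem integral_cutoff_mul_divergence {d : ℕ} (hd : d ≠ 0) {R : ℝ} (hR : 0 < R)
    {F : Euc d → Euc d} (hF : ContDiff ℝ 1 F) :
    ∫ x, cutoff R x * divergence F x =
      -∫ r in Set.Ioi (0 : ℝ), cutoffSlope R r *
        ∫ x, inner ℝ (F x) (outwardNormal x) ∂(sphereMeasure d r) := by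
  have hint : Integrable fun x => fderiv ℝ (cutoff R) x (F x) := by
    refine Continuous.integrable_of_hasCompactSupport
      (((contDiff_cutoff R).continuous_fderiv one_ne_zero).clm_apply hF.continuous) ?_
    refine ((hasCompactSupport_cutoff hR).fderiv (𝕜 := ℝ)).mono fun x hx h => hx ?_
    simp [h]
  rw [integral_mul_divergence (contDiff_cutoff R) (hasCompactSupport_cutoff hR) hF,
    integral_eq_integral_sphereMeasure hd hint]
  congr 1
  refine setIntegral_congr_fun measurableSet_Ioi fun r hr => ?_
  simp only [fderiv_cutoff_apply]
  exact integral_sphereMeasure_radial_mul hr (cutoffSlope R) _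

theorem tendsto_integral_cutoffSlope_mul {f : ℝ → ℝ} (hf : Tendsto f atTop (𝓝 0)) :
    Tendsto (fun R => ∫ r in Set.Ioi (0 : ℝ), cutoffSlope R r * f r) atTop (𝓝 0) := by
  obtain ⟨C, hC, hslope⟩ := exists_abs_cutoffSlope_le
  rw [Metric.tendsto_nhds] at hf ⊢
  intro ε hε
  have hδ : 0 < ε / (C + 1) := by positivity
  obtain ⟨R₀, hR₀⟩ := eventually_atTop.1 (hf _ hδ)
  filter_upwards [eventually_ge_atTop R₀, eventually_gt_atTop 0] with R hR hRpos
  have hbound : ∀ r ∈ Set.Ioi (0 : ℝ), ‖cutoffSlope R r * f r‖ ≤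
      (Set.Icc R (2 * R)).indicator (fun _ => C / R * (ε / (C + 1))) r := by
    intro r hr
    have hs := hslope R r hRpos hr
    rw [norm_mul, Real.norm_eq_abs]
    by_cases h : r ∈ Set.Icc R (2 * R)
    · rw [Set.indicator_of_mem h] at hs ⊢
      have := hR₀ r (hR.trans h.1)
      rw [dist_zero_right] at this
      gcongr
    · rw [Set.indicator_of_notMem h] at hs ⊢
      rw [le_antisymm hs (abs_nonneg _), zero_mul]
  have hIcc : Set.Ioi (0 : ℝ) ∩ Set.Icc R (2 * R) = Set.Icc R (2 * R) :=
    Set.inter_eq_right.2 fun r hr => hRpos.trans_le hr.1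
  have hi : IntegrableOn ((Set.Icc R (2 * R)).indicator fun _ => C / R * (ε / (C + 1)))
      (Set.Ioi (0 : ℝ)) :=
    (IntegrableOn.integrable_indicator
      (integrableOn_const (by simp)) measurableSet_Icc).integrableOn
  rw [dist_zero_right]
  calc ‖∫ r in Set.Ioi (0 : ℝ), cutoffSlope R r * f r‖
      ≤ ∫ r in Set.Ioi (0 : ℝ),
          (Set.Icc R (2 * R)).indicator (fun _ => C / R * (ε / (C + 1))) r :=
        norm_integral_le_of_norm_le hi
          ((ae_restrict_iff' measurableSet_Ioi).2 (.of_forall hbound))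
    _ = C * (ε / (C + 1)) := by
        rw [setIntegral_indicator measurableSet_Icc, hIcc, setIntegral_const,
          Real.volume_real_Icc_of_le (by linarith), smul_eq_mul]
        field_simp
        ring
    _ < ε := by
        rw [mul_div_assoc', div_lt_iff₀ (by positivity)]
        nlinarith

/-- Integrability is only needed to pass from the cutoff integrals to the whole space; for `d = 0`,
where polar coordinates are not available, every divergence is an empty sum. -/
theorem integral_divergence_eq_zero {d : ℕ} {F : Euc d → Euc d} (hF : ContDiff ℝ 1 F)
    (hint : Integrable (divergence F))
    (hflux : Tendsto (fun R => ∫ x, inner ℝ (F x) (outwardNormal x) ∂(sphereMeasure d R))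
      atTop (𝓝 0)) :
    ∫ x, divergence F x = 0 := by
  rcases eq_or_ne d 0 with rfl | hd
  · simp [divergence]
  have hleft : Tendsto (fun R : ℝ => ∫ x, cutoff R x * divergence F x) atTop
      (𝓝 (∫ x, divergence F x)) := by
    refine tendsto_integral_filter_of_dominated_convergence (fun x => ‖divergence F x‖)
      (.of_forall fun R => ((contDiff_cutoff R).continuous.mul
        (continuous_divergence hF)).aestronglyMeasurable)
      (.of_forall fun R => .of_forall fun x => ?_) hint.norm (.of_forall fun x => ?_)
    · rw [norm_mul]
      exact mul_le_of_le_one_left (norm_nonneg _) (norm_cutoff_le_one R x)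
    · refine tendsto_const_nhds.congr' ?_
      filter_upwards [eventually_ge_atTop ‖x‖, eventually_gt_atTop 0] with R hR hRpos
      rw [cutoff_eq_one hRpos hR, one_mul]
  have hright := (tendsto_integral_cutoffSlope_mul hflux).neg
  rw [neg_zero] at hright
  refine tendsto_nhds_unique hleft (hright.congr' ?_)
  filter_upwards [eventually_gt_atTop 0] with R hR
  exact (integral_cutoff_mul_divergence hd hR hF).symm

/-! ### The Stein identity -/

theorem IsC1Density.fderiv_eq_zero {d : ℕ} {p : Euc d → ℝ} (hp : IsC1Density p) {x : Euc d}
    (hx : p x = 0) : fderiv ℝ p x = 0 :=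
  IsLocalMin.fderiv_eq_zero (.of_forall fun y => hx.trans_le (hp.nonneg y))

theorem density_mul_inner_score {d : ℕ} {p : Euc d → ℝ} (hp : IsC1Density p) (x v : Euc d) :
    p x * inner ℝ v (score p x) = fderiv ℝ p x v := by
  by_cases hx : p x = 0
  · simp [hx, hp.fderiv_eq_zero hx]
  · have h := (hp.contDiff.differentiable one_ne_zero x).hasFDerivAt.log hx
    rw [score, gradient, real_inner_comm, InnerProductSpace.toDual_symm_apply, h.fderiv]
    simp [hx]

/-- Against the density, the Langevin Stein operator is a divergence, also at zeros of `p`. -/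
theorem density_mul_steinOp {d : ℕ} {p : Euc d → ℝ} (hp : IsC1Density p) {φ : Euc d → Euc d}
    (hφ : ContDiff ℝ 1 φ) (x : Euc d) :
    p x * steinOp p φ x = divergence (fun y => p y • φ y) x := by
  have hprod (i : Fin d) : partialDeriv i (fun y => (p y • φ y) i) x =
      p x * partialDeriv i (fun y => φ y i) x + φ x i * partialDeriv i p x := by
    simp only [partialDeriv, PiLp.smul_apply, smul_eq_mul]
    rw [fderiv_fun_mul (hp.contDiff.differentiable one_ne_zero x)
      (((contDiff_piLp 2).1 hφ i).differentiable one_ne_zero x)]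
    simp
  have hsum : fderiv ℝ p x (φ x) = ∑ i, φ x i * partialDeriv i p x := by
    conv_lhs => rw [← (EuclideanSpace.basisFun (Fin d) ℝ).sum_repr (φ x)]
    simp [partialDeriv]
  rw [steinOp, mul_add, density_mul_inner_score hp, hsum]
  simp only [divergence, hprod, Finset.sum_add_distrib, Finset.mul_sum]

theorem integral_law {d : ℕ} {p : Euc d → ℝ} (hp : IsC1Density p) (f : Euc d → ℝ) :
    ∫ x, f x ∂(law p) = ∫ x, p x * f x := by
  rw [law, integral_withDensity_eq_integral_toReal_smul
    hp.contDiff.continuous.measurable.ennreal_ofReal (.of_forall fun _ => ENNReal.ofReal_lt_top)]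
  simp only [ENNReal.toReal_ofReal (hp.nonneg _), smul_eq_mul]

theorem integrable_law_iff {d : ℕ} {p : Euc d → ℝ} (hp : IsC1Density p) (f : Euc d → ℝ) :
    Integrable f (law p) ↔ Integrable fun x => p x * f x := by
  rw [law, integrable_withDensity_iff_integrable_smul'
    hp.contDiff.continuous.measurable.ennreal_ofReal (.of_forall fun _ => ENNReal.ofReal_lt_top)]
  simp only [ENNReal.toReal_ofReal (hp.nonneg _), smul_eq_mul]

theorem integral_steinOp_eq_zero {d : ℕ} {p : Euc d → ℝ} (hp : IsC1Density p)
    {φ : Euc d → Euc d} (hφ : ContDiff ℝ 1 φ) (hint : Integrable (steinOp p φ) (law p))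
    (hflux : Tendsto (boundaryFlux p φ) atTop (𝓝 0)) :
    ∫ x, steinOp p φ x ∂(law p) = 0 := by
  rw [integrable_law_iff hp] at hint
  rw [integral_law hp]
  simp only [density_mul_steinOp hp hφ] at hint ⊢
  refine integral_divergence_eq_zero (hp.contDiff.smul hφ) hint ?_
  simp only [real_inner_smul_left]
  exact hflux

end LangevinStein

end

theorem mainTheorem5 (d m : ℕ) (p : LangevinStein.Euc d → ℝ)
    (hp : LangevinStein.IsC1Density p)
    (Φ : LangevinStein.Euc d → Matrix (Fin d) (Fin m) ℝ)
    (hΦ : ∀ i j, ContDiff ℝ 1 (fun x => Φ x i j))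
    (hint : ∀ j, Integrable (LangevinStein.steinOp p (LangevinStein.column Φ j))
      (LangevinStein.law p))
    (hbdry : ∀ j, Tendsto (LangevinStein.boundaryFlux p (LangevinStein.column Φ j))
      atTop (𝓝 0)) :
    Integrable (LangevinStein.genSteinOp p Φ) (LangevinStein.law p) ∧
      ∫ x, LangevinStein.genSteinOp p Φ x ∂(LangevinStein.law p) = 0 := by
  have hcol (j : Fin m) : ContDiff ℝ 1 (LangevinStein.column Φ j) :=
    (contDiff_piLp 2).2 fun i => hΦ i j
  have hcomp (j : Fin m) :
      Integrable (fun x => LangevinStein.genSteinOp p Φ x j) (LangevinStein.law p) := by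
    simpa only [LangevinStein.genSteinOp_apply] using hint j
  refine ⟨Integrable.of_eval_piLp hcomp, ?_⟩
  ext j
  rw [eval_integral_piLp hcomp]
  simpa only [LangevinStein.genSteinOp_apply, PiLp.zero_apply] using
    LangevinStein.integral_steinOp_eq_zero hp (hcol j) (hint j) (hbdry j)
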